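/- Let $I=\{0,1\}^3$. For $r\in(0,\infty)^3$ and $\mathbf i=i_1i_2i_3\in I$ put $r^{\mathbf i}=\prod_{k=1}^3 r_k^{1-2i_k}$, and for $s:I\to[0,\infty)$ put $$\delta_3(s)=\inf_{r\in(0,\infty)^3}\ \sum_{\mathbf i\in I}s_{\mathbf i}\,r^{\mathbf i}.$$ For $a:I\to[0,\infty)$ put $$\Delta_3(a)=\inf\Big\{\sum_{\mathbf i\in I}s_{\mathbf i}a_{\mathbf i}\ :\ s:I\to[0,\infty),\ \delta_3(s)=1\Big\}.$$ A finite multiset $T$ of elements of $I$ is balanced if, for each $k=1,2,3$, the number of $\mathbf i\in T$ with $i_k=0$ equals the number of $\mathbf i\in T$ with $i_k=1$ (counted with multiplicity). A nonempty balanced multiset is irreducible if it is not the multiset union of two nonempty balanced multisets. Put $$\tilde\Delta_3(a)=\inf\Big\{\Big(\prod_{\mathbf i\in T}a_{\mathbf i}\Big)^{1/\#T}\ :\ T\text{ an irreducible balanced multiset}\Big\}.$$ **Proposition 5.4.** For every $a:I\to[0,\infty)$ one has $\Delta_3(a)=\tilde\Delta_3(a)$. Moreover, the infimum defining $\tilde\Delta_3(a)$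 is attained, and $$\tilde\Delta_3(a)=\min\big\{\sqrt{a_{000}a_{111}},\ \sqrt{a_{001}a_{110}},\ \sqrt{a_{010}a_{101}},\ \sqrt{a_{011}a_{100}},\ \sqrt[4]{a_{000}a_{011}a_{101}a_{110}},\ \sqrt[4]{a_{111}a_{100}a_{010}a_{001}}\big\}.$$ -/

import Mathlib

namespace MultiQubit

/-- `n`-bit indices: functions from an `n`-element set into `{0, 1}`. -/
abbrev Index (n : ℕ) : Type := Fin n → Fin 2

/-- The monomial `r^i = ∏ₖ rₖ^(1 - 2 i(k))`, so the exponent is `+1` if `i(k) = 0` and `-1` if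
`i(k) = 1`. -/
noncomputable def monomial {n : ℕ} (r : Fin n → ℝ) (i : Index n) : ℝ :=
  ∏ k, r k ^ (1 - 2 * ((i k : ℕ) : ℤ))

/-- `δₙ(s) = inf { ∑ᵢ sᵢ r^i : r ∈ (0, ∞)ⁿ }`. For nonnegative `s` this is the infimum of a nonempty
set of nonnegative reals. -/
noncomputable def delta {n : ℕ} (s : Index n → ℝ) : ℝ :=
  sInf {x : ℝ | ∃ r : Fin n → ℝ, (∀ k, 0 < r k) ∧ x = ∑ i, s i * monomial r i}

/-- `Δₙ(a) = inf { ⟨s, a⟩ : s ≥ 0, δₙ(s) = 1 }`, where `⟨s, a⟩ = ∑ᵢ sᵢ aᵢ`. For nonnegative `a` this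
is the infimum of a nonempty set of nonnegative reals. -/
noncomputable def Delta (n : ℕ) (a : Index n → ℝ) : ℝ :=
  sInf {x : ℝ | ∃ s : Index n → ℝ, (∀ i, 0 ≤ s i) ∧ delta s = 1 ∧ x = ∑ i, s i * a i}

/-- A multiset of indices is balanced if, in every digit, the values `0` and `1` occur equally
often (with multiplicity). -/
def IsBalanced {n : ℕ} (T : Multiset (Index n)) : Prop :=
  ∀ k, T.countP (fun i => i k = 0) = T.countP (fun i => i k = 1)

/-- A (nonempty) balanced multiset is irreducible if it is not the multiset union of two nonempty
balanced multisets. -/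
def IsIrreducibleBalanced {n : ℕ} (T : Multiset (Index n)) : Prop :=
  T ≠ 0 ∧ IsBalanced T ∧
    ∀ T₁ T₂ : Multiset (Index n), IsBalanced T₁ → IsBalanced T₂ → T = T₁ + T₂ → T₁ = 0 ∨ T₂ = 0

/-- `Δ̃ₙ(a) = min { (∏_{i ∈ T} aᵢ)^(1/#T) : T irreducible balanced }`. There are only finitely many
irreducible balanced multisets of `n`-bit indices, so the infimum is a minimum for `n ≥ 1`. -/
noncomputable def DeltaTilde (n : ℕ) (a : Index n → ℝ) : ℝ :=
  sInf {x : ℝ | ∃ T : Multiset (Index n), IsIrreducibleBalanced T ∧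
    x = (T.map a).prod ^ (1 / (Multiset.card T : ℝ))}

end MultiQubit

namespace MultiQubit

open Finset Filter Topology

/-! Upper bound (`Delta_le_of_isBalanced`): over a balanced `T` the monomials `r^i` multiply to 1,
so weighted AM-GM turns `T` into a feasible `s` whose pairing with `a` is at most the geometric mean
over `T`. Lower bound (`le_Delta`): if some `r` has `m * r^i ≤ a i` for all `i`, then `⟨s, a⟩ ≥ m *
δ(s) = m`. In logarithms this is a linear system in three unknowns. It is solvable once `m` is at
most the six means (`exists_mul_monomial_le`). These six are exactly the means over irreducible
multisets (`isIrreducibleBalanced_three_iff`). -/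

lemma monomial_pos {n : ℕ} {r : Fin n → ℝ} (hr : ∀ k, 0 < r k) (i : Index n) :
    0 < monomial r i :=
  prod_pos fun k _ => zpow_pos (hr k) _

lemma log_monomial {n : ℕ} {r : Fin n → ℝ} (hr : ∀ k, 0 < r k) (i : Index n) :
    Real.log (monomial r i) = ∑ k, ((1 - 2 * ((i k : ℕ) : ℤ) : ℤ) : ℝ) * Real.log (r k) := by
  rw [monomial, Real.log_prod fun k _ => (zpow_pos (hr k) _).ne']
  exact sum_congr rfl fun k _ => Real.log_zpow _ _

lemma delta_le {n : ℕ} {s : Index n → ℝ} (hs : ∀ i, 0 ≤ s i) {r : Fin n → ℝ}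
    (hr : ∀ k, 0 < r k) : delta s ≤ ∑ i, s i * monomial r i := by
  refine csInf_le ⟨0, ?_⟩ ⟨r, hr, rfl⟩
  rintro x ⟨r, hr, rfl⟩
  exact sum_nonneg fun i _ => mul_nonneg (hs i) (monomial_pos hr i).le

lemma le_delta {n : ℕ} {s : Index n → ℝ} {c : ℝ}
    (h : ∀ r : Fin n → ℝ, (∀ k, 0 < r k) → c ≤ ∑ i, s i * monomial r i) : c ≤ delta s := by
  refine le_csInf ⟨_, 1, fun _ => one_pos, rfl⟩ ?_
  rintro x ⟨r, hr, rfl⟩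
  exact h r hr

lemma delta_mul_left {n : ℕ} {s : Index n → ℝ} (hs : ∀ i, 0 ≤ s i) {c : ℝ} (hc : 0 < c) :
    delta (fun i => c * s i) = c * delta s := by
  have key : ∀ r : Fin n → ℝ,
      ∑ i, c * s i * monomial r i = c * ∑ i, s i * monomial r i := fun r => by
    rw [mul_sum]
    exact sum_congr rfl fun i _ => mul_assoc _ _ _
  apply le_antisymm
  · rw [← div_le_iff₀' hc]
    refine le_delta fun r hr => ?_
    rw [div_le_iff₀' hc, ← key]
    exact delta_le (fun i => mul_nonneg hc.le (hs i)) hr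
  · refine le_delta fun r hr => ?_
    rw [key]
    exact mul_le_mul_of_nonneg_left (delta_le hs hr) hc.le

/-- The constraint `delta s = 1` in the definition of `Delta` may be relaxed to `1 ≤ delta s`. -/
lemma Delta_le_of_one_le_delta {n : ℕ} {a s : Index n → ℝ} (ha : ∀ i, 0 ≤ a i)
    (hs : ∀ i, 0 ≤ s i) (h : 1 ≤ delta s) : Delta n a ≤ ∑ i, s i * a i := by
  have hpos : 0 < delta s := one_pos.trans_le h
  have hle : Delta n a ≤ ∑ i, (delta s)⁻¹ * s i * a i := by
    refine csInf_le ⟨0, ?_⟩ ⟨fun i => (delta s)⁻¹ * s i,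
      fun i => mul_nonneg (inv_nonneg.2 hpos.le) (hs i), ?_, rfl⟩
    · rintro x ⟨s, hs, -, rfl⟩
      exact sum_nonneg fun i _ => mul_nonneg (hs i) (ha i)
    · rw [delta_mul_left hs (inv_pos.2 hpos), inv_mul_cancel₀ hpos.ne']
  refine hle.trans (sum_le_sum fun i _ => mul_le_mul_of_nonneg_right ?_ (ha i))
  exact mul_le_of_le_one_left (hs i) (inv_le_one_of_one_le₀ h)

/-! ### Upper bound from balanced multisets. -/

lemma countP_sub_countP {n : ℕ} (T : Multiset (Index n)) (k : Fin n) :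
    (T.countP (fun i => i k = 0) : ℤ) - T.countP (fun i => i k = 1) =
      ∑ i, (T.count i : ℤ) * (1 - 2 * ((i k : ℕ) : ℤ)) := by
  induction T using Multiset.induction_on with
  | empty => simp
  | cons j T ih =>
    simp only [Multiset.countP_cons, Multiset.count_cons, Nat.cast_add, add_mul, sum_add_distrib,
      ← ih]
    have : ∑ i : Index n, ((if i = j then 1 else 0 : ℕ) : ℤ) * (1 - 2 * ((i k : ℕ) : ℤ)) =
        1 - 2 * ((j k : ℕ) : ℤ) := by simp
    rw [this]
    generalize j k = b
    fin_cases b <;> simp <;> ring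

lemma isBalanced_iff_sum_count {n : ℕ} {T : Multiset (Index n)} :
    IsBalanced T ↔ ∀ k, ∑ i, (T.count i : ℤ) * (1 - 2 * ((i k : ℕ) : ℤ)) = 0 := by
  simp only [IsBalanced, ← countP_sub_countP, sub_eq_zero, Nat.cast_inj]

lemma sum_count_mul_log_monomial {n : ℕ} {T : Multiset (Index n)} (hT : IsBalanced T)
    {r : Fin n → ℝ} (hr : ∀ k, 0 < r k) :
    ∑ i, (T.count i : ℝ) * Real.log (monomial r i) = 0 := by
  simp only [log_monomial hr, mul_sum]
  rw [sum_comm]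
  refine sum_eq_zero fun k _ => ?_
  have h := congrArg (Int.cast : ℤ → ℝ) (isBalanced_iff_sum_count.1 hT k)
  simp only [← mul_assoc, ← sum_mul]
  push_cast at h ⊢
  rw [h, zero_mul]

lemma sum_count_eq_card {n : ℕ} (T : Multiset (Index n)) :
    ∑ i, T.count i = Multiset.card T :=
  Multiset.sum_count_eq_card fun _ _ => mem_univ _

lemma prod_map_eq_prod_pow_count {n : ℕ} (T : Multiset (Index n)) (a : Index n → ℝ) :
    (T.map a).prod = ∏ i, a i ^ T.count i :=
  prod_multiset_map_count T a |>.trans <| prod_subset (subset_univ _) fun i _ hi => by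
    rw [Multiset.count_eq_zero_of_notMem (by simpa using hi), pow_zero]

/-- The witness `s i = (count i / N) * (G / b i)` makes the AM-GM lower bound exactly 1. It divides
by `b`, hence a positive majorant of `a`, which may vanish. -/
lemma Delta_le_of_pos {n : ℕ} {a b : Index n → ℝ} (ha : ∀ i, 0 ≤ a i) (hab : ∀ i, a i ≤ b i)
    (hb : ∀ i, 0 < b i) {T : Multiset (Index n)} (hT₀ : T ≠ 0) (hT : IsBalanced T) :
    Delta n a ≤ (T.map b).prod ^ (1 / (Multiset.card T : ℝ)) := by
  have hN : (0 : ℝ) < Multiset.card T := by exact_mod_cast Multiset.card_pos.2 hT₀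
  set N : ℝ := (Multiset.card T : ℝ) with hNdef
  set P : ℝ := (T.map b).prod with hP
  have hP_pos : 0 < P := by
    rw [hP, prod_map_eq_prod_pow_count]
    exact prod_pos fun i _ => pow_pos (hb i) _
  have hG : 0 < P ^ (1 / N) := Real.rpow_pos_of_pos hP_pos _
  set G := P ^ (1 / N) with hGdef
  have hlogG : N * Real.log G = ∑ i, (T.count i : ℝ) * Real.log (b i) := by
    rw [hGdef, Real.log_rpow hP_pos, hP, prod_map_eq_prod_pow_count,
      Real.log_prod fun i _ => (pow_pos (hb i) _).ne']
    simp only [Real.log_pow]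
    field_simp
  have hsum : ∑ i, (T.count i : ℝ) = N := by
    rw [hNdef, ← sum_count_eq_card]
    push_cast
    rfl
  have hw : ∑ i, (T.count i : ℝ) / N = 1 := by
    rw [← sum_div, hsum, div_self hN.ne']
  have hw₀ : ∀ i, 0 ≤ (T.count i : ℝ) / N := fun i => div_nonneg (Nat.cast_nonneg _) hN.le
  have hs : ∀ i, 0 ≤ (T.count i : ℝ) / N * (G / b i) := fun i =>
    mul_nonneg (hw₀ i) (div_pos hG (hb i)).le
  have hδ : 1 ≤ delta fun i => (T.count i : ℝ) / N * (G / b i) := by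
    refine le_delta fun r hr => ?_
    have hz : ∀ i, 0 < G / b i * monomial r i := fun i =>
      mul_pos (div_pos hG (hb i)) (monomial_pos hr i)
    have amgm := Real.geom_mean_le_arith_mean_weighted univ (fun i => (T.count i : ℝ) / N)
      (fun i => G / b i * monomial r i) (fun i _ => hw₀ i) hw fun i _ => (hz i).le
    have hprod : ∏ i, (G / b i * monomial r i) ^ ((T.count i : ℝ) / N) = 1 := by
      apply Real.eq_one_of_pos_of_log_eq_zero
        (prod_pos fun i _ => Real.rpow_pos_of_pos (hz i) _)
      rw [Real.log_prod fun i _ => (Real.rpow_pos_of_pos (hz i) _).ne']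
      have : ∀ i, Real.log ((G / b i * monomial r i) ^ ((T.count i : ℝ) / N)) =
          ((T.count i : ℝ) * Real.log G - T.count i * Real.log (b i) +
            T.count i * Real.log (monomial r i)) / N := fun i => by
        rw [Real.log_rpow (hz i), Real.log_mul (div_pos hG (hb i)).ne' (monomial_pos hr i).ne',
          Real.log_div hG.ne' (hb i).ne']
        ring
      simp only [this]
      rw [← sum_div, sum_add_distrib, sum_sub_distrib, sum_count_mul_log_monomial hT hr,
        ← sum_mul, hsum, hlogG]
      simp
    rw [hprod] at amgm
    simpa only [mul_assoc] using amgm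
  refine (Delta_le_of_one_le_delta ha hs hδ).trans ?_
  calc ∑ i, (T.count i : ℝ) / N * (G / b i) * a i ≤ ∑ i, (T.count i : ℝ) / N * G := by
        refine sum_le_sum fun i _ => ?_
        rw [mul_assoc, div_mul_eq_mul_div G]
        exact mul_le_mul_of_nonneg_left
          ((div_le_iff₀ (hb i)).2 (mul_le_mul_of_nonneg_left (hab i) hG.le)) (hw₀ i)
    _ = G := by rw [← sum_mul, hw, one_mul]

/-- Each nonempty balanced multiset bounds `Delta` by the geometric mean of `a` over it. -/
lemma Delta_le_of_isBalanced {n : ℕ} {a : Index n → ℝ} (ha : ∀ i, 0 ≤ a i)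
    {T : Multiset (Index n)} (hT₀ : T ≠ 0) (hT : IsBalanced T) :
    Delta n a ≤ (T.map a).prod ^ (1 / (Multiset.card T : ℝ)) := by
  -- Zeros of `a` are handled by letting `b = a + ε` with `ε → 0`. The base may vanish in the limit,
  -- so continuity uses that the exponent is nonnegative.
  have hcont : Continuous fun ε : ℝ =>
      (T.map fun i => a i + ε).prod ^ (1 / (Multiset.card T : ℝ)) := by
    simp only [prod_map_eq_prod_pow_count]
    exact Continuous.rpow_const (by fun_prop) fun _ => Or.inr (by positivity)
  have hlim := (hcont.tendsto 0).mono_left (nhdsWithin_le_nhds (s := Set.Ioi 0))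
  simp only [add_zero] at hlim
  refine ge_of_tendsto hlim ?_
  filter_upwards [self_mem_nhdsWithin] with ε hε
  have hε : 0 < ε := hε
  exact Delta_le_of_pos ha (fun i => by linarith) (fun i => by linarith [ha i]) hT₀ hT

/-! ### Irreducible balanced multisets of three-bit indices. -/

lemma sum_index_three {M : Type*} [AddCommMonoid M] (f : Index 3 → M) :
    ∑ i, f i = f ![0, 0, 0] + (f ![0, 0, 1] + (f ![0, 1, 0] + (f ![0, 1, 1] +
      (f ![1, 0, 0] + (f ![1, 0, 1] + (f ![1, 1, 0] + f ![1, 1, 1])))))) := by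
  have h : (univ : Finset (Index 3)) = {![0, 0, 0], ![0, 0, 1], ![0, 1, 0], ![0, 1, 1],
      ![1, 0, 0], ![1, 0, 1], ![1, 1, 0], ![1, 1, 1]} := by decide
  rw [h]
  repeat rw [sum_insert (by decide)]
  rw [sum_singleton]

lemma forall_index_three {p : Index 3 → Prop} :
    (∀ i, p i) ↔ p ![0, 0, 0] ∧ p ![0, 0, 1] ∧ p ![0, 1, 0] ∧ p ![0, 1, 1] ∧
      p ![1, 0, 0] ∧ p ![1, 0, 1] ∧ p ![1, 1, 0] ∧ p ![1, 1, 1] := by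
  have h : ∀ i : Index 3, i = ![0, 0, 0] ∨ i = ![0, 0, 1] ∨ i = ![0, 1, 0] ∨ i = ![0, 1, 1] ∨
      i = ![1, 0, 0] ∨ i = ![1, 0, 1] ∨ i = ![1, 1, 0] ∨ i = ![1, 1, 1] := by decide
  refine ⟨fun hp => by simp only [hp, and_self], ?_⟩
  rintro ⟨h0, h1, h2, h3, h4, h5, h6, h7⟩ i
  rcases h i with rfl | rfl | rfl | rfl | rfl | rfl | rfl | rfl <;> assumption

/-- The four pairs of complementary indices and the two tetrads of indices of equal parity. -/
def circuits : Set (Multiset (Index 3)) :=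
  {{![0, 0, 0], ![1, 1, 1]}, {![0, 0, 1], ![1, 1, 0]}, {![0, 1, 0], ![1, 0, 1]},
    {![0, 1, 1], ![1, 0, 0]}, {![0, 0, 0], ![0, 1, 1], ![1, 0, 1], ![1, 1, 0]},
    {![1, 1, 1], ![1, 0, 0], ![0, 1, 0], ![0, 0, 1]}}

lemma isBalanced_three_iff {T : Multiset (Index 3)} :
    IsBalanced T ↔
      T.count ![0, 0, 0] + T.count ![1, 0, 0] = T.count ![0, 1, 1] + T.count ![1, 1, 1] ∧
      T.count ![0, 0, 0] + T.count ![0, 1, 0] = T.count ![1, 0, 1] + T.count ![1, 1, 1] ∧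
      T.count ![0, 0, 0] + T.count ![0, 0, 1] = T.count ![1, 1, 0] + T.count ![1, 1, 1] := by
  rw [isBalanced_iff_sum_count, Fin.forall_fin_succ, Fin.forall_fin_succ, Fin.forall_fin_succ]
  simp [sum_index_three]
  omega

lemma eq_zero_three_iff {T : Multiset (Index 3)} :
    T = 0 ↔ T.count ![0, 0, 0] + T.count ![0, 0, 1] + T.count ![0, 1, 0] + T.count ![0, 1, 1] +
      T.count ![1, 0, 0] + T.count ![1, 0, 1] + T.count ![1, 1, 0] + T.count ![1, 1, 1] = 0 := by
  rw [← Multiset.card_eq_zero, ← sum_count_eq_card, sum_index_three]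
  simp only [add_assoc]

/-- Balance says that the differences (count of `i`) - (count of its complement), `i` of even
parity, all agree. In a part of a pair this common value is 0; in a part of a tetrad the four counts
agree. All counts being at most 1, the part is empty or everything. -/
lemma isIrreducibleBalanced_of_mem_circuits {C : Multiset (Index 3)} (hC : C ∈ circuits) :
    IsIrreducibleBalanced C := by
  have key : C ≠ 0 ∧ IsBalanced C := by
    rcases hC with rfl | rfl | rfl | rfl | rfl | rfl <;>
      exact ⟨by decide, by unfold IsBalanced; decide⟩
  refine ⟨key.1, key.2, fun T₁ T₂ h₁ h₂ h => ?_⟩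
  rw [isBalanced_three_iff] at h₁ h₂
  rw [eq_zero_three_iff, eq_zero_three_iff]
  rw [Multiset.ext, forall_index_three] at h
  simp only [Multiset.count_add] at h
  generalize T₁.count ![0, 0, 0] = x0 at *
  generalize T₁.count ![0, 0, 1] = x1 at *
  generalize T₁.count ![0, 1, 0] = x2 at *
  generalize T₁.count ![0, 1, 1] = x3 at *
  generalize T₁.count ![1, 0, 0] = x4 at *
  generalize T₁.count ![1, 0, 1] = x5 at *
  generalize T₁.count ![1, 1, 0] = x6 at *
  generalize T₁.count ![1, 1, 1] = x7 at *
  generalize T₂.count ![0, 0, 0] = y0 at *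
  generalize T₂.count ![0, 0, 1] = y1 at *
  generalize T₂.count ![0, 1, 0] = y2 at *
  generalize T₂.count ![0, 1, 1] = y3 at *
  generalize T₂.count ![1, 0, 0] = y4 at *
  generalize T₂.count ![1, 0, 1] = y5 at *
  generalize T₂.count ![1, 1, 0] = y6 at *
  generalize T₂.count ![1, 1, 1] = y7 at *
  rcases hC with rfl | rfl | rfl | rfl | rfl | rfl <;>
  · simp [Multiset.insert_eq_cons] at h
    omega

/-- If the common difference is positive, `T` contains the even tetrad; if negative, the odd one; if
zero, a complementary pair. -/
lemma exists_circuit_le {T : Multiset (Index 3)} (hT₀ : T ≠ 0) (hT : IsBalanced T) :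
    ∃ C ∈ circuits, C ≤ T := by
  rw [isBalanced_three_iff] at hT
  rw [ne_eq, eq_zero_three_iff] at hT₀
  by_contra! h
  simp only [circuits, Set.forall_mem_insert, Set.mem_singleton_iff, forall_eq,
    Multiset.le_iff_count, forall_index_three] at h
  simp [Multiset.insert_eq_cons, -Multiset.count_eq_zero] at h
  generalize T.count ![0, 0, 0] = x0 at *
  generalize T.count ![0, 0, 1] = x1 at *
  generalize T.count ![0, 1, 0] = x2 at *
  generalize T.count ![0, 1, 1] = x3 at *
  generalize T.count ![1, 0, 0] = x4 at *
  generalize T.count ![1, 0, 1] = x5 at *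
  generalize T.count ![1, 1, 0] = x6 at *
  generalize T.count ![1, 1, 1] = x7 at *
  omega

lemma isIrreducibleBalanced_three_iff {T : Multiset (Index 3)} :
    IsIrreducibleBalanced T ↔ T ∈ circuits := by
  refine ⟨fun ⟨h₀, hb, hirr⟩ => ?_, isIrreducibleBalanced_of_mem_circuits⟩
  obtain ⟨C, hC, hle⟩ := exists_circuit_le h₀ hb
  obtain ⟨D, rfl⟩ := Multiset.le_iff_exists_add.1 hle
  have hCirr := isIrreducibleBalanced_of_mem_circuits hC
  have hD : IsBalanced D := fun k => by
    have h1 := hb k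
    have h2 := hCirr.2.1 k
    simp only [Multiset.countP_add] at h1
    omega
  rcases hirr C D hCirr.2.1 hD rfl with h | h
  · exact absurd h hCirr.1
  · rwa [h, add_zero]

lemma setOf_irreducible_eq (a : Index 3 → ℝ) :
    {x : ℝ | ∃ T : Multiset (Index 3), IsIrreducibleBalanced T ∧
      x = (T.map a).prod ^ (1 / (Multiset.card T : ℝ))} =
    {√(a ![0, 0, 0] * a ![1, 1, 1]), √(a ![0, 0, 1] * a ![1, 1, 0]),
      √(a ![0, 1, 0] * a ![1, 0, 1]), √(a ![0, 1, 1] * a ![1, 0, 0]),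
      (a ![0, 0, 0] * a ![0, 1, 1] * a ![1, 0, 1] * a ![1, 1, 0]) ^ (1 / 4 : ℝ),
      (a ![1, 1, 1] * a ![1, 0, 0] * a ![0, 1, 0] * a ![0, 0, 1]) ^ (1 / 4 : ℝ)} := by
  ext x
  simp only [isIrreducibleBalanced_three_iff, circuits, Set.mem_ofPred_eq, Set.mem_insert_iff,
    Set.mem_singleton_iff, or_and_right, exists_or, exists_eq_left, Multiset.insert_eq_cons,
    Multiset.map_cons, Multiset.map_singleton, Multiset.prod_cons, Multiset.prod_singleton,
    Multiset.card_cons, Multiset.card_singleton, Real.sqrt_eq_rpow, ← mul_assoc]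
  norm_num

/-! ### Lower bound from the six means. -/

/-- Four intervals contain numbers with sum zero if the sums of their endpoints permit it. -/
lemma exists_sum_eq_zero {L U : Fin 4 → ℝ} (hLU : ∀ j, L j ≤ U j) (hL : ∑ j, L j ≤ 0)
    (hU : 0 ≤ ∑ j, U j) : ∃ y : Fin 4 → ℝ, (∀ j, L j ≤ y j ∧ y j ≤ U j) ∧ ∑ j, y j = 0 := by
  -- Slide all four points from `L` to `U` simultaneously and apply the intermediate value theorem
  -- to their sum.
  have hcont : ContinuousOn (fun t : ℝ => ∑ j, (L j + t * (U j - L j))) (Set.Icc 0 1) := by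
    fun_prop
  obtain ⟨t, ⟨ht0, ht1⟩, ht⟩ := intermediate_value_Icc zero_le_one hcont
    (show (0 : ℝ) ∈ Set.Icc _ _ by simpa using ⟨hL, hU⟩)
  refine ⟨_, fun j => ⟨?_, ?_⟩, ht⟩ <;> nlinarith [hLU j]

/-- The logarithms `y` of the four even-parity monomials are subject only to having sum zero, and
the odd ones are their negatives. Each complementary pair thus confines one `y j` to an interval:
the pair bounds make it nonempty, the tetrad bounds permit sum zero. -/
lemma exists_mul_monomial_le {a : Index 3 → ℝ} (ha : ∀ i, 0 < a i) {m : ℝ} (hm : 0 < m)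
    (h1 : m ^ 2 ≤ a ![0, 0, 0] * a ![1, 1, 1]) (h2 : m ^ 2 ≤ a ![0, 0, 1] * a ![1, 1, 0])
    (h3 : m ^ 2 ≤ a ![0, 1, 0] * a ![1, 0, 1]) (h4 : m ^ 2 ≤ a ![0, 1, 1] * a ![1, 0, 0])
    (h5 : m ^ 4 ≤ a ![0, 0, 0] * a ![0, 1, 1] * a ![1, 0, 1] * a ![1, 1, 0])
    (h6 : m ^ 4 ≤ a ![1, 1, 1] * a ![1, 0, 0] * a ![0, 1, 0] * a ![0, 0, 1]) :
    ∃ r : Fin 3 → ℝ, (∀ k, 0 < r k) ∧ ∀ i, m * monomial r i ≤ a i := by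
  have two : ∀ {i j : Index 3}, m ^ 2 ≤ a i * a j →
      2 * Real.log m ≤ Real.log (a i) + Real.log (a j) := fun {i j} h => by
    have := Real.log_le_log (pow_pos hm 2) h
    rwa [Real.log_pow, Real.log_mul (ha i).ne' (ha j).ne'] at this
  have four : ∀ {i j k l : Index 3}, m ^ 4 ≤ a i * a j * a k * a l →
      4 * Real.log m ≤ Real.log (a i) + Real.log (a j) + Real.log (a k) + Real.log (a l) :=
    fun {i j k l} h => by
      have := Real.log_le_log (pow_pos hm 4) h
      rwa [Real.log_pow, Real.log_mul (mul_pos (mul_pos (ha i) (ha j)) (ha k)).ne' (ha l).ne',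
        Real.log_mul (mul_pos (ha i) (ha j)).ne' (ha k).ne',
        Real.log_mul (ha i).ne' (ha j).ne'] at this
  replace h1 := two h1
  replace h2 := two h2
  replace h3 := two h3
  replace h4 := two h4
  replace h5 := four h5
  replace h6 := four h6
  let b : Index 3 → ℝ := fun i => Real.log (a i) - Real.log m
  obtain ⟨y, hy, hsum⟩ := exists_sum_eq_zero
    (L := ![-b ![1, 1, 1], -b ![1, 0, 0], -b ![0, 1, 0], -b ![0, 0, 1]])
    (U := ![b ![0, 0, 0], b ![0, 1, 1], b ![1, 0, 1], b ![1, 1, 0]])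
    (by intro j; fin_cases j <;> simp [b] <;> linarith)
    (by simp [Fin.sum_univ_four, b]; linarith) (by simp [Fin.sum_univ_four, b]; linarith)
  have y0 := hy 0
  have y1 := hy 1
  have y2 := hy 2
  have y3 := hy 3
  simp [b] at y0 y1 y2 y3
  rw [Fin.sum_univ_four] at hsum
  -- Solves `log r^000 = y 0`, `log r^011 = y 1`, `log r^101 = y 2`, `log r^110 = y 3`, using that
  -- `y` sums to zero.
  let r : Fin 3 → ℝ := ![Real.exp ((y 0 + y 1) / 2), Real.exp ((y 0 + y 2) / 2),
    Real.exp ((y 0 + y 3) / 2)]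
  have hr : ∀ k, 0 < r k := by
    intro k
    fin_cases k <;> exact Real.exp_pos _
  refine ⟨r, hr, fun i => ?_⟩
  rw [← Real.log_le_log_iff (mul_pos hm (monomial_pos hr i)) (ha i),
    Real.log_mul hm.ne' (monomial_pos hr i).ne', log_monomial hr]
  revert i
  rw [forall_index_three]
  simp [Fin.sum_univ_three, r]
  refine ⟨?_, ?_, ?_, ?_, ?_, ?_, ?_, ?_⟩ <;> linarith

lemma le_Delta_of_mul_monomial_le {n : ℕ} {a : Index n → ℝ} {m : ℝ} (hm : 0 ≤ m)
    (hne : ∃ s : Index n → ℝ, (∀ i, 0 ≤ s i) ∧ delta s = 1) {r : Fin n → ℝ}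
    (hr : ∀ k, 0 < r k) (h : ∀ i, m * monomial r i ≤ a i) : m ≤ Delta n a := by
  obtain ⟨s₀, hs₀, hδ₀⟩ := hne
  refine le_csInf ⟨_, s₀, hs₀, hδ₀, rfl⟩ ?_
  rintro x ⟨s, hs, hδ, rfl⟩
  calc m = m * delta s := by rw [hδ, mul_one]
    _ ≤ m * ∑ i, s i * monomial r i := mul_le_mul_of_nonneg_left (delta_le hs hr) hm
    _ = ∑ i, s i * (m * monomial r i) := by
        rw [mul_sum]
        exact sum_congr rfl fun i _ => mul_left_comm _ _ _
    _ ≤ _ := sum_le_sum fun i _ => mul_le_mul_of_nonneg_left (h i) (hs i)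

/-- Feasibility matters because `sInf ∅ = 0` in `ℝ`. The constant 1 has positive `delta`, as `r^000
* r^111 = 1`, and is rescaled. -/
lemma exists_delta_eq_one : ∃ s : Index 3 → ℝ, (∀ i, 0 ≤ s i) ∧ delta s = 1 := by
  have h0 : ∀ i : Index 3, (0 : ℝ) ≤ 1 := fun _ => zero_le_one
  have hpos : 0 < delta fun _ : Index 3 => (1 : ℝ) := by
    refine one_pos.trans_le (le_delta fun r hr => ?_)
    have hp := monomial_pos hr
    have hmul : monomial r ![0, 0, 0] * monomial r ![1, 1, 1] = 1 := by
      have h (k) := (hr k).ne'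
      simp [monomial, Fin.prod_univ_three]
      field_simp [h 0, h 1, h 2]
    rw [sum_index_three]
    nlinarith [hp ![0, 0, 0], hp ![0, 0, 1], hp ![0, 1, 0], hp ![0, 1, 1], hp ![1, 0, 0],
      hp ![1, 0, 1], hp ![1, 1, 0], hp ![1, 1, 1],
      sq_nonneg (monomial r ![0, 0, 0] - monomial r ![1, 1, 1])]
  exact ⟨fun _ => (delta fun _ : Index 3 => (1 : ℝ))⁻¹ * 1,
    fun _ => mul_nonneg (inv_nonneg.2 hpos.le) zero_le_one,
    (delta_mul_left h0 (inv_pos.2 hpos)).trans (inv_mul_cancel₀ hpos.ne')⟩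

lemma le_Delta {a : Index 3 → ℝ} (ha : ∀ i, 0 ≤ a i) {m : ℝ}
    (hm : m ∈ lowerBounds ({√(a ![0, 0, 0] * a ![1, 1, 1]), √(a ![0, 0, 1] * a ![1, 1, 0]),
      √(a ![0, 1, 0] * a ![1, 0, 1]), √(a ![0, 1, 1] * a ![1, 0, 0]),
      (a ![0, 0, 0] * a ![0, 1, 1] * a ![1, 0, 1] * a ![1, 1, 0]) ^ (1 / 4 : ℝ),
      (a ![1, 1, 1] * a ![1, 0, 0] * a ![0, 1, 0] * a ![0, 0, 1]) ^ (1 / 4 : ℝ)} : Set ℝ)) :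
    m ≤ Delta 3 a := by
  rcases le_or_gt m 0 with hm0 | hm0
  · refine hm0.trans (Real.sInf_nonneg ?_)
    rintro x ⟨s, hs, -, rfl⟩
    exact sum_nonneg fun i _ => mul_nonneg (hs i) (ha i)
  have two : ∀ {i j : Index 3}, m ≤ √(a i * a j) → m ^ 2 ≤ a i * a j := fun {i j} h =>
    (Real.le_sqrt hm0.le (mul_nonneg (ha i) (ha j))).1 h
  have four : ∀ {x : ℝ}, 0 ≤ x → m ≤ x ^ (1 / 4 : ℝ) → m ^ 4 ≤ x := fun {x} hx h => by
    calc m ^ 4 ≤ (x ^ (1 / 4 : ℝ)) ^ 4 := pow_le_pow_left₀ hm0.le h 4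
      _ = x := by rw [← Real.rpow_natCast, ← Real.rpow_mul hx]; norm_num
  have prod_nonneg : ∀ i j k l, 0 ≤ a i * a j * a k * a l := fun i j k l =>
    mul_nonneg (mul_nonneg (mul_nonneg (ha i) (ha j)) (ha k)) (ha l)
  have h1 := two (hm (by simp : √(a ![0, 0, 0] * a ![1, 1, 1]) ∈ _))
  have h2 := two (hm (by simp : √(a ![0, 0, 1] * a ![1, 1, 0]) ∈ _))
  have h3 := two (hm (by simp : √(a ![0, 1, 0] * a ![1, 0, 1]) ∈ _))
  have h4 := two (hm (by simp : √(a ![0, 1, 1] * a ![1, 0, 0]) ∈ _))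
  have h5 := four (prod_nonneg _ _ _ _) (hm (by simp :
    (a ![0, 0, 0] * a ![0, 1, 1] * a ![1, 0, 1] * a ![1, 1, 0]) ^ (1 / 4 : ℝ) ∈ _))
  have h6 := four (prod_nonneg _ _ _ _) (hm (by simp :
    (a ![1, 1, 1] * a ![1, 0, 0] * a ![0, 1, 0] * a ![0, 0, 1]) ^ (1 / 4 : ℝ) ∈ _))
  -- For `m > 0` the pair bounds force every entry of `a` to be positive, so logarithms are
  -- available.
  have pos : ∀ {i j : Index 3}, m ^ 2 ≤ a i * a j → 0 < a i ∧ 0 < a j := fun {i j} h => by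
    have hij : 0 < a i * a j := (pow_pos hm0 2).trans_le h
    exact ⟨pos_of_mul_pos_left hij (ha j), pos_of_mul_pos_right hij (ha i)⟩
  have ha' : ∀ i, 0 < a i := forall_index_three.2 ⟨(pos h1).1, (pos h2).1, (pos h3).1,
    (pos h4).1, (pos h4).2, (pos h3).2, (pos h2).2, (pos h1).2⟩
  obtain ⟨r, hr, h⟩ := exists_mul_monomial_le ha' hm0 h1 h2 h3 h4 h5 h6
  exact le_Delta_of_mul_monomial_le hm0.le exists_delta_eq_one hr h

end MultiQubit

theorem proposition5p4 (a : MultiQubit.Index 3 → ℝ) (ha : ∀ i, 0 ≤ a i) :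
    MultiQubit.Delta 3 a = MultiQubit.DeltaTilde 3 a ∧
    IsLeast {x : ℝ | ∃ T : Multiset (MultiQubit.Index 3), MultiQubit.IsIrreducibleBalanced T ∧
      x = (T.map a).prod ^ (1 / (Multiset.card T : ℝ))} (MultiQubit.DeltaTilde 3 a) ∧
    IsLeast ({√(a ![0, 0, 0] * a ![1, 1, 1]), √(a ![0, 0, 1] * a ![1, 1, 0]),
      √(a ![0, 1, 0] * a ![1, 0, 1]), √(a ![0, 1, 1] * a ![1, 0, 0]),
      (a ![0, 0, 0] * a ![0, 1, 1] * a ![1, 0, 1] * a ![1, 1, 0]) ^ (1 / 4 : ℝ),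
      (a ![1, 1, 1] * a ![1, 0, 0] * a ![0, 1, 0] * a ![0, 0, 1]) ^ (1 / 4 : ℝ)} : Set ℝ)
      (MultiQubit.DeltaTilde 3 a) := by
  have hleast : IsLeast {x : ℝ | ∃ T : Multiset (MultiQubit.Index 3),
      MultiQubit.IsIrreducibleBalanced T ∧ x = (T.map a).prod ^ (1 / (Multiset.card T : ℝ))}
      (MultiQubit.DeltaTilde 3 a) := by
    have hfin : {x : ℝ | ∃ T : Multiset (MultiQubit.Index 3),
        MultiQubit.IsIrreducibleBalanced T ∧
          x = (T.map a).prod ^ (1 / (Multiset.card T : ℝ))}.Finite := by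
      rw [MultiQubit.setOf_irreducible_eq]
      exact Set.toFinite _
    refine ⟨Set.Nonempty.csInf_mem ?_ hfin, fun x hx => csInf_le hfin.bddBelow hx⟩
    rw [MultiQubit.setOf_irreducible_eq]
    exact Set.insert_nonempty _ _
  have hleast' := hleast
  rw [MultiQubit.setOf_irreducible_eq] at hleast'
  refine ⟨le_antisymm ?_ ?_, hleast, hleast'⟩
  · obtain ⟨T, hT, h⟩ := hleast.1
    rw [h]
    exact MultiQubit.Delta_le_of_isBalanced ha hT.1 hT.2.1
  · exact MultiQubit.le_Delta ha hleast'.2
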